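/- Let $A$ be a finite, commutative, principal ideal, local ring with Jacobson radical $\mathfrak r$ and residue field $A/\mathfrak r\cong F_q$ of odd characteristic. Let $e$ be the nilpotency degree of $\mathfrak r$, i.e. the least integer $e$ with $\mathfrak r^e=0$ (so $e\ge 1$, and $e=1$ when $A$ is a field). Let $*$ be an involution of $A$, i.e. a ring automorphism of $A$ with $(a^*)^*=a$ for all $a\in A$, such that $a-a^*\in\mathfrak r$ for all $a\in A$. Let $m\ge 0$ be an integer and let $U_{2m}(A)$ be the group of all $X\in \mathrm{GL}_{2m}(A)$ such that $X^*JX=J$, where $(X^*)_{ij}=(X_{ji})^*$ and $J=\begin{pmatrix}0&1\\-1&0\end{pmatrix}$ with blocks of size $m\times m$. (a) If $*=1_A$, then $$|U_{2m}(A)|=|\mathrm{Sp}_{2m}(A)|=q^{(e-1)(2m^2+m)+m^2}\prod_{i=1}^m(q^{2i}-1).$$ (b) If $*\neq 1_A$ and $e=2\ell$ is even, then $$|U_{2m}(A)|=q^{(2\ell-1)(2m^2-m)}\,q^{2(\ell-1)m}\,q^{m^2}\prod_{i=1}^m(q^{2i}-1).$$ (c) If $*\neq 1_A$ and $e=2\ell-1$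 is odd, then $$|U_{2m}(A)|=q^{(2\ell-2)(2m^2-m)}\,q^{2(\ell-1)m}\,q^{m^2}\prod_{i=1}^m(q^{2i}-1).$$ -/

import Mathlib

open Matrix

/-- The `2m × 2m` block matrix `J = (0, 1; -1, 0)`, with blocks of size `m × m`. -/
def stdSkewForm (m : ℕ) (A : Type*) [CommRing A] :
    Matrix (Fin m ⊕ Fin m) (Fin m ⊕ Fin m) A :=
  Matrix.fromBlocks 0 1 (-1) 0

/-- The unitary group `U_{2m}(A)` of a commutative ring `A` with involution `*`: the group of all
`X ∈ GL_{2m}(A)` with `X^* J X = J`, where `(X^*)_{ij} = (X_{ji})^*`. -/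
def skewUnitaryGroup (m : ℕ) (A : Type*) [CommRing A] [StarRing A] :
    Subgroup (Matrix.GeneralLinearGroup (Fin m ⊕ Fin m) A) where
  carrier := {X | (X.val)ᴴ * stdSkewForm m A * X.val = stdSkewForm m A}
  one_mem' := by simp
  mul_mem' := by
    intro X Y hX hY
    simp only [Set.mem_ofPred_eq] at hX hY ⊢
    rw [Units.val_mul, Matrix.conjTranspose_mul]
    calc _ = (Y.val)ᴴ * ((X.val)ᴴ * stdSkewForm m A * X.val) * Y.val := by
          simp only [Matrix.mul_assoc]
      _ = _ := by rw [hX, hY]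
  inv_mem' := by
    intro X hX
    simp only [Set.mem_ofPred_eq] at hX ⊢
    have h1 : X.val * (X⁻¹).val = 1 := X.mul_inv
    have h2 : ((X⁻¹).val)ᴴ * (X.val)ᴴ = 1 := by
      rw [← Matrix.conjTranspose_mul, h1, Matrix.conjTranspose_one]
    calc ((X⁻¹).val)ᴴ * stdSkewForm m A * (X⁻¹).val
        = ((X⁻¹).val)ᴴ * ((X.val)ᴴ * stdSkewForm m A * X.val) * (X⁻¹).val := by rw [hX]
      _ = (((X⁻¹).val)ᴴ * (X.val)ᴴ) * stdSkewForm m A * (X.val * (X⁻¹).val) := by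
          simp only [Matrix.mul_assoc]
      _ = _ := by rw [h1, h2, Matrix.one_mul, Matrix.mul_one]

/-! The columns of a matrix in `U_{2m}(A)` are exactly `m` mutually orthogonal hyperbolic pairs for
`(u, v) ↦ u^* J v`, so the order is a count of such families, made by splitting off one pair at a
time. Let `S` be the skew elements, `M` the maximal ideal and `R` the residual radical of `W`. There
are `(|W| - |R|) |W| / |A|` pairs with `h u v = 1` (`card_unimodular_pairs_mul_card`). The values `h
u u` and `h v v` lie in `S`, and all `|S|^2` choices of them occur equally often
(`card_pairsWithGram`): skew elements lie in `M` and `2` is a unit, so the diagonal can always be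
corrected to zero. Passing to the orthogonal complement of a hyperbolic pair divides `|W|` by
`|A|^2` and `|R|` by `|M|^2`, which gives the product in `card_hyperbolicFamilies_mul`. There remain
`|A| = q^e`, `|M| = q^(e-1)` and `|S|`. If `* = 1` then `S = 0`. Otherwise `M` has a skew generator
`y` (`exists_skew_generator_maximalIdeal`), and multiplication by `y` maps symmetric elements onto
skew ones. Its kernel is the symmetric part of `Ann(y) = (y^(e-1))`, of order `1` or `q` according
as `e` is even or odd. As symmetric and skew elements together decompose `A`, this fixes `|S|`. -/

/-! ### Pairs of vectors with prescribed Gram matrix -/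

section HyperbolicPairs

variable {A V : Type*} [CommRing A] [StarRing A] [AddCommGroup V] [Module A V]

/-- The pairs of vectors of `W` with Gram matrix `(s, 1; -1, t)`. -/
def pairsWithGram (h : V →ₗ⋆[A] V →ₗ[A] A) (W : Submodule A V) (s t : A) : Set (V × V) :=
  {p | p.1 ∈ W ∧ p.2 ∈ W ∧ h p.1 p.2 = 1 ∧ h p.1 p.1 = s ∧ h p.2 p.2 = t}

/-- The vectors of `W` pairing with all of `W` into the maximal ideal. -/
def residualRadical [IsLocalRing A] (h : V →ₗ⋆[A] V →ₗ[A] A) (W : Submodule A V) : Set V :=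
  {u | u ∈ W ∧ ∀ v ∈ W, h u v ∈ IsLocalRing.maximalIdeal A}

lemma isUnit_add_mem_maximalIdeal {A : Type*} [CommRing A] [IsLocalRing A] {a b : A} (ha : IsUnit a)
    (hb : b ∈ IsLocalRing.maximalIdeal A) : IsUnit (a + b) := by
  by_contra hc
  have h1 : a + b ∈ IsLocalRing.maximalIdeal A := hc
  have h2 := (IsLocalRing.maximalIdeal A).sub_mem h1 hb
  rw [add_sub_cancel_right] at h2
  exact h2 ha

lemma mem_maximalIdeal_of_star_eq_neg [IsLocalRing A] (h2 : IsUnit (2 : A))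
    (hstar : ∀ a : A, a - star a ∈ IsLocalRing.maximalIdeal A) {s : A} (hs : star s = -s) :
    s ∈ IsLocalRing.maximalIdeal A := by
  have h := hstar s
  rw [hs, sub_neg_eq_add, ← two_mul] at h
  obtain ⟨c, hc⟩ := h2.exists_left_inv
  have := (IsLocalRing.maximalIdeal A).mul_mem_left c h
  rwa [← mul_assoc, hc, one_mul] at this

/-- Injectivity of `α ↦ 2α - α²t` on the finite set of skew elements makes it surjective. -/
lemma exists_skew_two_mul_sub_sq_mul_eq [Finite A] [IsLocalRing A] (h2 : IsUnit (2 : A))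
    (hstar : ∀ a : A, a - star a ∈ IsLocalRing.maximalIdeal A) {s t : A}
    (hs : star s = -s) (ht : star t = -t) :
    ∃ α : A, star α = -α ∧ s + 2 * α - α ^ 2 * t = 0 := by
  have hstar2 : star (2 : A) = 2 := by simp
  let f : {a : A // star a = -a} → {a : A // star a = -a} := fun α =>
    ⟨2 * α.1 - α.1 ^ 2 * t, by
      rw [star_sub, star_mul', star_mul', star_pow, α.2, ht, hstar2]; ring⟩
  have hf : Function.Injective f := by
    intro α β hαβ
    have h0 : 2 * α.1 - α.1 ^ 2 * t = 2 * β.1 - β.1 ^ 2 * t := congrArg Subtype.val hαβ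
    -- The difference of the two values is `(α - β)(2 - (α + β)t)`, and `t` lies in the maximal
    -- ideal.
    have hu : IsUnit (2 + -((α.1 + β.1) * t)) := by
      refine isUnit_add_mem_maximalIdeal h2 (neg_mem (Ideal.mul_mem_left _ _ ?_))
      exact mem_maximalIdeal_of_star_eq_neg h2 hstar ht
    have h1 : (2 + -((α.1 + β.1) * t)) * (α.1 - β.1) = 0 := by linear_combination h0
    exact Subtype.ext (sub_eq_zero.1 ((hu.mul_right_eq_zero).1 h1))
  obtain ⟨α, hα⟩ := Finite.surjective_of_injective hf ⟨-s, by rw [star_neg, hs]⟩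
  have h0 : 2 * α.1 - α.1 ^ 2 * t = -s := congrArg Subtype.val hα
  exact ⟨α.1, α.2, by linear_combination h0⟩

variable {h : V →ₗ⋆[A] V →ₗ[A] A} {W : Submodule A V}

lemma star_apply_self (hskew : ∀ u v, star (h u v) = -h v u) (u : V) :
    star (h u u) = -h u u := hskew u u

lemma apply_swap_of_apply_eq_one (hskew : ∀ u v, star (h u v) = -h v u) {u v : V}
    (huv : h u v = 1) : h v u = -1 := by
  have := hskew u v
  rw [huv, star_one] at this
  rw [this, neg_neg]

/-- With `c = t / 2`, which is skew, replacing `v` by `v + c u` lowers `h v v` by `2c = t`. -/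
lemma card_pairsWithGram_zero_left (hskew : ∀ u v, star (h u v) = -h v u) (h2 : IsUnit (2 : A))
    {t : A} (ht : star t = -t) :
    Nat.card (pairsWithGram h W 0 t) = Nat.card (pairsWithGram h W 0 0) := by
  obtain ⟨c, hc⟩ : ∃ c : A, t = 2 * c := by
    obtain ⟨c, hc⟩ := h2.exists_right_inv
    exact ⟨c * t, by rw [← mul_assoc, hc, one_mul]⟩
  have hcs : star c = -c := by
    have hstar2 : star (2 : A) = 2 := by simp
    rw [hc, star_mul', hstar2] at ht
    exact h2.mul_left_cancel (by rw [ht]; ring)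
  refine Nat.card_congr
    { toFun := fun p => ⟨(p.1.1, p.1.2 + c • p.1.1), ?_⟩
      invFun := fun p => ⟨(p.1.1, p.1.2 - c • p.1.1), ?_⟩
      left_inv := fun p => by simp
      right_inv := fun p => by simp }
  · obtain ⟨⟨u, v⟩, hu, hv, h1, huu, hvv⟩ := p
    have h1' := apply_swap_of_apply_eq_one hskew h1
    refine ⟨hu, W.add_mem hv (W.smul_mem _ hu), ?_, huu, ?_⟩ <;>
      simp_all [starRingEnd_apply]
    ring
  · obtain ⟨⟨u, v⟩, hu, hv, h1, huu, hvv⟩ := p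
    have h1' := apply_swap_of_apply_eq_one hskew h1
    refine ⟨hu, W.sub_mem hv (W.smul_mem _ hu), ?_, huu, ?_⟩ <;>
      simp_all [starRingEnd_apply]
    ring

/-- For skew `α`, `h (u + αv) (u + αv) = s + 2α - α²t`, so a root `α` makes the first vector
isotropic. Then `h (u + αv) v = 1 - αt` is a symmetric unit `w`, and rescaling `v` by `w⁻¹` restores
the pairing `1`, which reduces to the case `s = 0`. -/
lemma card_pairsWithGram [Finite A] [IsLocalRing A] (hskew : ∀ u v, star (h u v) = -h v u)
    (h2 : IsUnit (2 : A)) (hstar : ∀ a : A, a - star a ∈ IsLocalRing.maximalIdeal A)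
    {s t : A} (hs : star s = -s) (ht : star t = -t) :
    Nat.card (pairsWithGram h W s t) = Nat.card (pairsWithGram h W 0 0) := by
  obtain ⟨α, hα, hαst⟩ := exists_skew_two_mul_sub_sq_mul_eq h2 hstar hs ht
  have hw : IsUnit (1 + -(α * t)) := isUnit_add_mem_maximalIdeal isUnit_one
    (neg_mem (Ideal.mul_mem_left _ _ (mem_maximalIdeal_of_star_eq_neg h2 hstar ht)))
  obtain ⟨w', hw'⟩ := hw.exists_right_inv
  obtain ⟨w, hwdef⟩ : ∃ w, w = 1 + -(α * t) := ⟨_, rfl⟩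
  rw [← hwdef] at hw hw'
  have hws : star w = w := by
    rw [hwdef, star_add, star_neg, star_mul', hα, ht, star_one]; ring
  have hws' : star w' = w' := by
    have := congrArg star hw'
    rw [star_mul', hws, star_one] at this
    exact hw.mul_left_cancel (by rw [this, hw'])
  have ht' : star (w' ^ 2 * t) = -(w' ^ 2 * t) := by
    rw [star_mul', star_pow, hws', ht]; ring
  rw [← card_pairsWithGram_zero_left hskew h2 ht']
  refine Nat.card_congr
    { toFun := fun p => ⟨(p.1.1 + α • p.1.2, w' • p.1.2), ?_⟩
      invFun := fun p => ⟨(p.1.1 - (α * w) • p.1.2, w • p.1.2), ?_⟩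
      left_inv := fun p => ?_
      right_inv := fun p => ?_ }
  · obtain ⟨⟨u, v⟩, hu, hv, h1, huu, hvv⟩ := p
    dsimp only at hu hv h1 huu hvv
    have h1' := apply_swap_of_apply_eq_one hskew h1
    refine ⟨W.add_mem hu (W.smul_mem _ hv), W.smul_mem _ hv, ?_, ?_, ?_⟩ <;>
      simp only [map_add, map_smul, map_smulₛₗ, LinearMap.add_apply, LinearMap.smul_apply,
        smul_eq_mul, starRingEnd_apply, h1, h1', huu, hvv, hα, hws']
    · linear_combination hw' - w' * hwdef
    · linear_combination hαst
    · ring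
  · obtain ⟨⟨u, v⟩, hu, hv, h1, huu, hvv⟩ := p
    dsimp only at hu hv h1 huu hvv
    have h1' := apply_swap_of_apply_eq_one hskew h1
    refine ⟨W.sub_mem hu (W.smul_mem _ hv), W.smul_mem _ hv, ?_, ?_, ?_⟩ <;>
      simp only [map_sub, map_smul, map_smulₛₗ, LinearMap.sub_apply, LinearMap.smul_apply,
        smul_eq_mul, starRingEnd_apply, h1, h1', huu, hvv, star_mul', hα, hws]
    · linear_combination hwdef + (α * t * (w * w' + 1)) * hw'
    · linear_combination (-2 * α) * hwdef - α ^ 2 * t * (w * w' + 1) * hw' - hαst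
    · linear_combination t * (w * w' + 1) * hw'
  · obtain ⟨⟨u, v⟩, hp⟩ := p
    simp [smul_smul, hw', mul_assoc]
  · obtain ⟨⟨u, v⟩, hp⟩ := p
    simp [smul_smul, hw', mul_comm w' w]

end HyperbolicPairs

/-! ### Counting orthogonal families of hyperbolic pairs -/

section HyperbolicFamilies

variable {A V : Type*} [CommRing A] [StarRing A] [AddCommGroup V] [Module A V]
  {h : V →ₗ⋆[A] V →ₗ[A] A} {W : Submodule A V}

/-- The fibres of a surjective linear functional on `W` all have `|W| / |A|` elements. -/
lemma card_apply_eq_one_mul_card {u v : V} (hv : v ∈ W) (huv : h u v = 1) :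
    Nat.card {x : V // x ∈ W ∧ h u x = 1} * Nat.card A = Nat.card W := by
  rw [← Nat.card_prod]
  refine Nat.card_congr
    { toFun := fun p => ⟨p.1.1 + (p.2 - 1) • v, W.add_mem p.1.2.1 (W.smul_mem _ hv)⟩
      invFun := fun x => ⟨⟨x.1 - (h u x - 1) • v, W.sub_mem x.2 (W.smul_mem _ hv), ?_⟩, h u x⟩
      left_inv := ?_
      right_inv := fun x => by simp }
  · simp [huv]
  · rintro ⟨⟨x, hx, hx1⟩, a⟩
    simp [huv, hx1]

lemma exists_apply_eq_one_of_notMem_residualRadical [IsLocalRing A] {u : V} (hu : u ∈ W)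
    (h0 : u ∉ residualRadical h W) : ∃ v ∈ W, h u v = 1 := by
  have : ∃ v ∈ W, h u v ∉ IsLocalRing.maximalIdeal A := by
    by_contra hc
    push Not at hc
    exact h0 ⟨hu, hc⟩
  obtain ⟨v, hv, hv1⟩ := this
  have hunit : IsUnit (h u v) := by simpa using hv1
  obtain ⟨c, hc⟩ := hunit.exists_left_inv
  exact ⟨c • v, W.smul_mem _ hv, by simpa using hc⟩

lemma card_sigma_const {α : Type*} [Finite α] {β : α → Type*} [∀ a, Finite (β a)] {n : ℕ}
    (hβ : ∀ a, Nat.card (β a) = n) : Nat.card (Σ a, β a) = Nat.card α * n := by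
  have := Fintype.ofFinite α
  rw [Nat.card_sigma, Finset.sum_congr rfl fun a _ => hβ a]
  simp

/-- A vector `u` of `W` has a partner exactly when it is outside the residual radical, and its
partners then form a fibre of the surjective functional `h u` on `W`. -/
lemma card_unimodular_pairs_mul_card [Finite A] [Finite V] [IsLocalRing A] :
    Nat.card {p : V × V // p.1 ∈ W ∧ p.2 ∈ W ∧ h p.1 p.2 = 1} * Nat.card A =
      (Nat.card W - Nat.card (residualRadical h W)) * Nat.card W := by
  let U : Set V := {u | u ∈ W ∧ u ∉ residualRadical h W}
  have hU : Nat.card U = Nat.card W - Nat.card (residualRadical h W) := by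
    have hUd : U = (W : Set V) \ residualRadical h W := rfl
    have hsub : residualRadical h W ⊆ W := fun x hx => hx.1
    rw [hUd, Nat.card_coe_set_eq, Set.ncard_sdiff hsub, Nat.card_coe_set_eq]
    rfl
  let e : ({p : V × V // p.1 ∈ W ∧ p.2 ∈ W ∧ h p.1 p.2 = 1} × A) ≃
      Σ u : U, {x : V // x ∈ W ∧ h u.1 x = 1} × A :=
    { toFun := fun p => ⟨⟨p.1.1.1, p.1.2.1, fun hr => by
          have := hr.2 _ p.1.2.2.1
          rw [p.1.2.2.2] at this
          exact this isUnit_one⟩, ⟨p.1.1.2, p.1.2.2⟩, p.2⟩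
      invFun := fun p => ⟨⟨(p.1.1, p.2.1.1), p.1.2.1, p.2.1.2⟩, p.2.2⟩
      left_inv := fun p => rfl
      right_inv := fun p => rfl }
  rw [← Nat.card_prod, Nat.card_congr e, card_sigma_const (n := Nat.card W), hU]
  rintro ⟨u, hu, hu0⟩
  obtain ⟨v, hv, huv⟩ := exists_apply_eq_one_of_notMem_residualRadical hu hu0
  rw [Nat.card_prod]
  exact card_apply_eq_one_mul_card hv huv

lemma card_unimodular_pairs [Finite A] [Finite V] [IsLocalRing A]
    (hskew : ∀ u v, star (h u v) = -h v u)
    (h2 : IsUnit (2 : A)) (hstar : ∀ a : A, a - star a ∈ IsLocalRing.maximalIdeal A) :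
    Nat.card {p : V × V // p.1 ∈ W ∧ p.2 ∈ W ∧ h p.1 p.2 = 1} =
      Nat.card (skewAdjoint A) ^ 2 * Nat.card (pairsWithGram h W 0 0) := by
  let e : {p : V × V // p.1 ∈ W ∧ p.2 ∈ W ∧ h p.1 p.2 = 1} ≃
      Σ st : skewAdjoint A × skewAdjoint A, pairsWithGram h W st.1.1 st.2.1 :=
    { toFun := fun p => ⟨(⟨h p.1.1 p.1.1, star_apply_self hskew _⟩,
          ⟨h p.1.2 p.1.2, star_apply_self hskew _⟩), ⟨p.1, p.2.1, p.2.2.1, p.2.2.2, rfl, rfl⟩⟩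
      invFun := fun p => ⟨p.2.1, p.2.2.1, p.2.2.2.1, p.2.2.2.2.1⟩
      left_inv := fun p => rfl
      right_inv := by
        rintro ⟨⟨⟨s, hs⟩, ⟨t, ht⟩⟩, ⟨p, h1, h2, h3, h4, h5⟩⟩
        dsimp only at h4 h5
        subst h4 h5
        rfl }
  rw [Nat.card_congr e, card_sigma_const (n := Nat.card (pairsWithGram h W 0 0)), Nat.card_prod, sq]
  rintro ⟨s, t⟩
  exact card_pairsWithGram hskew h2 hstar s.2 t.2

/-- The vectors of `W` orthogonal to both `u` and `v`. -/
def pairOrthogonal (h : V →ₗ⋆[A] V →ₗ[A] A) (W : Submodule A V) (p : V × V) : Submodule A V :=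
  W ⊓ LinearMap.ker (h p.1) ⊓ LinearMap.ker (h p.2)

lemma mem_pairOrthogonal {p : V × V} {x : V} :
    x ∈ pairOrthogonal h W p ↔ x ∈ W ∧ h p.1 x = 0 ∧ h p.2 x = 0 := by
  simp [pairOrthogonal, and_assoc]

/-- A hyperbolic pair splits off from `W`. -/
def pairOrthogonalEquiv (hskew : ∀ u v, star (h u v) = -h v u) {p : V × V}
    (hp : p ∈ pairsWithGram h W 0 0) : W ≃ (A × A) × pairOrthogonal h W p where
  toFun x := ((h p.1 x, h p.2 x), ⟨x - h p.1 x • p.2 + h p.2 x • p.1, by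
    obtain ⟨hu, hv, h1, huu, hvv⟩ := hp
    have h1' := apply_swap_of_apply_eq_one hskew h1
    rw [mem_pairOrthogonal]
    refine ⟨W.add_mem (W.sub_mem x.2 (W.smul_mem _ hv)) (W.smul_mem _ hu), ?_, ?_⟩ <;>
      simp [h1, huu, hvv, h1']⟩)
  invFun y := ⟨y.2.1 + y.1.1 • p.2 - y.1.2 • p.1,
    W.sub_mem (W.add_mem (mem_pairOrthogonal.1 y.2.2).1 (W.smul_mem _ hp.2.1))
      (W.smul_mem _ hp.1)⟩
  left_inv x := Subtype.ext (by dsimp only; abel)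
  right_inv := by
    rintro ⟨⟨a, b⟩, ⟨y, hy⟩⟩
    obtain ⟨hyW, hy1, hy2⟩ := mem_pairOrthogonal.1 hy
    obtain ⟨hu, hv, h1, huu, hvv⟩ := hp
    have h1' := apply_swap_of_apply_eq_one hskew h1
    simp only [map_add, map_sub, map_smul, smul_eq_mul, h1, huu, hvv, h1', hy1, hy2, mul_zero,
      mul_one, zero_add, sub_zero, add_zero, mul_neg, zero_sub, neg_neg, Prod.mk.injEq,
      Subtype.mk.injEq, true_and]
    abel

lemma card_pairOrthogonal_mul (hskew : ∀ u v, star (h u v) = -h v u) {p : V × V}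
    (hp : p ∈ pairsWithGram h W 0 0) :
    Nat.card A ^ 2 * Nat.card (pairOrthogonal h W p) = Nat.card W := by
  rw [Nat.card_congr (pairOrthogonalEquiv hskew hp), Nat.card_prod, Nat.card_prod, sq]

/-- The splitting of `W` into the hyperbolic plane and its complement respects residual radicals; in
the plane, the radical consists of the vectors with both coordinates in the maximal ideal. -/
lemma card_residualRadical_pairOrthogonal_mul [IsLocalRing A]
    (hskew : ∀ u v, star (h u v) = -h v u)
    {p : V × V} (hp : p ∈ pairsWithGram h W 0 0) :
    Nat.card (IsLocalRing.maximalIdeal A) ^ 2 *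
        Nat.card (residualRadical h (pairOrthogonal h W p)) =
      Nat.card (residualRadical h W) := by
  have hswap : ∀ u v, h u v = 0 → h v u = 0 := fun u v huv => by
    rw [← neg_eq_zero, ← hskew, huv, star_zero]
  have hstarmem : ∀ u v, h u v ∈ IsLocalRing.maximalIdeal A →
      h v u ∈ IsLocalRing.maximalIdeal A := fun u v huv => by
    have hiff : IsUnit (star (h u v)) ↔ IsUnit (h u v) := isUnit_star
    rw [hskew, IsUnit.neg_iff] at hiff
    simpa [hiff] using huv
  have hp' := hp
  obtain ⟨hu, hv, h1, huu, hvv⟩ := hp'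
  have h1' := apply_swap_of_apply_eq_one hskew h1
  rw [sq, ← Nat.card_prod, ← Nat.card_prod]
  refine Nat.card_congr
    { toFun := fun y => ⟨y.2.1 + y.1.1.1 • p.2 - y.1.2.1 • p.1, ?_, ?_⟩
      invFun := fun x => ((⟨h p.1 x, hstarmem _ _ (x.2.2 _ hu)⟩,
        ⟨h p.2 x, hstarmem _ _ (x.2.2 _ hv)⟩), ⟨x - h p.1 x • p.2 + h p.2 x • p.1, ?_, ?_⟩)
      left_inv := ?_
      right_inv := fun x => Subtype.ext (by dsimp only; abel) }
  · exact W.sub_mem (W.add_mem (mem_pairOrthogonal.1 y.2.2.1).1 (W.smul_mem _ hv))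
      (W.smul_mem _ hu)
  · obtain ⟨⟨⟨a, ha⟩, ⟨b, hb⟩⟩, ⟨y, hy, hyr⟩⟩ := y
    have hunit_star : ∀ c ∈ IsLocalRing.maximalIdeal A, star c ∈ IsLocalRing.maximalIdeal A :=
      fun c hc => by simpa using hc
    intro z hz
    obtain ⟨hyW, hy1, hy2⟩ := mem_pairOrthogonal.1 hy
    -- Since `y` is orthogonal to the pair, it pairs with `z` as it does with the projection of `z`
    -- to the complement.
    have hz' := hyr (z - h p.1 z • p.2 + h p.2 z • p.1)
      (pairOrthogonalEquiv hskew hp ⟨z, hz⟩).2.2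
    have e1 := hswap _ _ hy1
    have e2 := hswap _ _ hy2
    simp only [map_add, map_sub, map_smul, e1, e2, smul_zero, sub_zero, add_zero] at hz'
    simp only [map_add, map_sub, map_smulₛₗ, LinearMap.add_apply, LinearMap.sub_apply,
      LinearMap.smul_apply, smul_eq_mul, starRingEnd_apply]
    exact sub_mem (add_mem hz' (Ideal.mul_mem_right _ _ (hunit_star a ha)))
      (Ideal.mul_mem_right _ _ (hunit_star b hb))
  · exact (pairOrthogonalEquiv hskew hp ⟨x.1, x.2.1⟩).2.2
  · intro z hz
    obtain ⟨hzW, hz1, hz2⟩ := mem_pairOrthogonal.1 hz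
    simpa [hz1, hz2] using x.2.2 z hzW
  · rintro ⟨⟨⟨a, ha⟩, ⟨b, hb⟩⟩, ⟨y, hy, hyr⟩⟩
    obtain ⟨hyW, hy1, hy2⟩ := mem_pairOrthogonal.1 hy
    simp only [map_add, map_sub, map_smul, smul_eq_mul, h1, huu, hvv, h1', hy1, hy2, mul_zero,
      mul_one, zero_add, sub_zero, add_zero, mul_neg, zero_sub, neg_neg, Prod.mk.injEq,
      true_and]
    exact Subtype.ext (by dsimp only; abel)

/-- The families of `m` pairwise orthogonal hyperbolic pairs in `W`. -/
def hyperbolicFamilies (h : V →ₗ⋆[A] V →ₗ[A] A) (m : ℕ) (W : Submodule A V) :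
    Set ((Fin m → V) × (Fin m → V)) :=
  {f | (∀ i, f.1 i ∈ W ∧ f.2 i ∈ W) ∧ ∀ i j, h (f.1 i) (f.1 j) = 0 ∧ h (f.2 i) (f.2 j) = 0 ∧
    h (f.1 i) (f.2 j) = if i = j then 1 else 0}

/-- A family of `m + 1` hyperbolic pairs is a pair and a family of `m` pairs orthogonal to it. -/
def hyperbolicFamiliesSuccEquiv (hskew : ∀ u v, star (h u v) = -h v u) (m : ℕ) :
    hyperbolicFamilies h (m + 1) W ≃
      Σ p : pairsWithGram h W 0 0, hyperbolicFamilies h m (pairOrthogonal h W p.1) where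
  toFun f := ⟨⟨(f.1.1 0, f.1.2 0), (f.2.1 0).1, (f.2.1 0).2, by simpa using (f.2.2 0 0).2.2,
      (f.2.2 0 0).1, (f.2.2 0 0).2.1⟩,
    ⟨(fun i => f.1.1 i.succ, fun i => f.1.2 i.succ), by
      have hswap : ∀ u v, h u v = 0 → h v u = 0 := fun u v huv => by
        rw [← neg_eq_zero, ← hskew, huv, star_zero]
      refine ⟨fun i => ⟨?_, ?_⟩, fun i j => ?_⟩
      · refine mem_pairOrthogonal.2 ⟨(f.2.1 _).1, (f.2.2 _ _).1, hswap _ _ ?_⟩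
        simpa using (f.2.2 i.succ 0).2.2
      · refine mem_pairOrthogonal.2 ⟨(f.2.1 _).2, ?_, (f.2.2 _ _).2.1⟩
        simpa [(Fin.succ_ne_zero _).symm] using (f.2.2 0 i.succ).2.2
      · simpa using f.2.2 i.succ j.succ⟩⟩
  invFun g := ⟨(Fin.cons g.1.1.1 g.2.1.1, Fin.cons g.1.1.2 g.2.1.2), by
    obtain ⟨⟨p, hu, hv, h1, huu, hvv⟩, ⟨g, hgW, hg⟩⟩ := g
    have hswap : ∀ u v, h u v = 0 → h v u = 0 := fun u v huv => by
      rw [← neg_eq_zero, ← hskew, huv, star_zero]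
    simp only [mem_pairOrthogonal] at hgW
    refine ⟨Fin.cases ⟨hu, hv⟩ fun i => ⟨(hgW i).1.1, (hgW i).2.1⟩, ?_⟩
    refine Fin.cases (Fin.cases ⟨huu, hvv, by simpa using h1⟩ fun j => ?_)
      fun i => Fin.cases ?_ fun j => ?_
    · simp [hgW j, (Fin.succ_ne_zero _).symm]
    · simp [hswap _ _ (hgW i).1.2.1, hswap _ _ (hgW i).2.2.2, hswap _ _ (hgW i).1.2.2]
    · simpa using hg i j⟩
  left_inv f := by
    apply Subtype.ext
    apply Prod.ext <;> funext i <;> refine Fin.cases ?_ (fun i => ?_) i <;> rfl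
  right_inv g := rfl

/-- The number of hyperbolic families spanning a regular space of rank `2m`. -/
lemma card_hyperbolicFamilies_mul [Finite A] [Finite V] [IsLocalRing A]
    (hskew : ∀ u v, star (h u v) = -h v u)
    (h2 : IsUnit (2 : A)) (hstar : ∀ a : A, a - star a ∈ IsLocalRing.maximalIdeal A) (m : ℕ) :
    ∀ W : Submodule A V, Nat.card W = Nat.card A ^ (2 * m) →
      Nat.card (residualRadical h W) = Nat.card (IsLocalRing.maximalIdeal A) ^ (2 * m) →
      Nat.card (hyperbolicFamilies h m W) * (Nat.card (skewAdjoint A) ^ 2 * Nat.card A) ^ m =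
        ∏ i ∈ Finset.Icc 1 m,
          (Nat.card A ^ (2 * i) - Nat.card (IsLocalRing.maximalIdeal A) ^ (2 * i)) *
            Nat.card A ^ (2 * i) := by
  induction m with
  | zero =>
    intro W _ _
    have : hyperbolicFamilies h 0 W = Set.univ := by
      ext f; simp [hyperbolicFamilies]
    rw [this]
    simp
  | succ m ih =>
    intro W hW hR
    have hA : 0 < Nat.card A := Nat.card_pos
    have hM : 0 < Nat.card (IsLocalRing.maximalIdeal A) := Nat.card_pos
    rw [Finset.prod_Icc_succ_top (by omega)]
    have hpairs := card_unimodular_pairs_mul_card (h := h) (W := W)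
    rw [card_unimodular_pairs hskew h2 hstar, hW, hR] at hpairs
    -- The common fibre size is expressed through a chosen pair `p0`; with no pairs at all, both
    -- sides are zero by `hpairs`.
    by_cases hne : Nonempty (pairsWithGram h W 0 0)
    · obtain ⟨p0⟩ := hne
      have hfib : ∀ p : pairsWithGram h W 0 0,
          Nat.card (hyperbolicFamilies h m (pairOrthogonal h W p.1)) *
            (Nat.card (skewAdjoint A) ^ 2 * Nat.card A) ^ m =
          ∏ i ∈ Finset.Icc 1 m,
            (Nat.card A ^ (2 * i) - Nat.card (IsLocalRing.maximalIdeal A) ^ (2 * i)) *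
              Nat.card A ^ (2 * i) := by
        intro p
        apply ih
        · apply Nat.eq_of_mul_eq_mul_left (pow_pos hA 2)
          rw [card_pairOrthogonal_mul hskew p.2, hW]; ring
        · apply Nat.eq_of_mul_eq_mul_left (pow_pos hM 2)
          rw [card_residualRadical_pairOrthogonal_mul hskew p.2, hR]; ring
      have hc : 0 < (Nat.card (skewAdjoint A) ^ 2 * Nat.card A) ^ m := by
        have : 0 < Nat.card (skewAdjoint A) := Nat.card_pos
        positivity
      rw [Nat.card_congr (hyperbolicFamiliesSuccEquiv hskew m),
        card_sigma_const
          (n := Nat.card (hyperbolicFamilies h m (pairOrthogonal h W p0.1)))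
          (fun p => Nat.eq_of_mul_eq_mul_right hc ((hfib p).trans (hfib p0).symm)),
        ← hfib p0, ← hpairs]
      ring
    · rw [not_nonempty_iff] at hne
      have := (hyperbolicFamiliesSuccEquiv (W := W) hskew m).isEmpty
      rw [← hpairs]
      simp

end HyperbolicFamilies

/-! ### Cardinalities in a principal local ring -/

section PrincipalLocalRing

variable {A : Type*} [CommRing A]

lemma mem_maximalIdeal_of_mul_eq_zero [IsLocalRing A] {a b : A} (hab : a * b = 0) (hb : b ≠ 0) :
    a ∈ IsLocalRing.maximalIdeal A := fun ha => hb (ha.mul_right_eq_zero.1 hab)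

/-- If `a = b x^k` with `k < e - 1`, then `b` kills `x^(k+1) ≠ 0`, so `b` is not a unit and
contributes another factor `x`. -/
lemma exists_eq_mul_pow_of_mul_eq_zero [IsLocalRing A] {x : A} {e : ℕ}
    (hx : IsLocalRing.maximalIdeal A = Ideal.span {x}) (hne : x ^ (e - 1) ≠ 0)
    {a : A} (ha : a * x = 0) : ∃ b, a = b * x ^ (e - 1) := by
  suffices ∀ k ≤ e - 1, ∃ b, a = b * x ^ k from this _ le_rfl
  intro k
  induction k with
  | zero => exact fun _ => ⟨a, by simp⟩
  | succ k ih =>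
    intro hk
    obtain ⟨b, hb⟩ := ih (by omega)
    have hb' : b ∈ IsLocalRing.maximalIdeal A := by
      refine mem_maximalIdeal_of_mul_eq_zero (b := x ^ (k + 1)) ?_ fun h0 => hne ?_
      · rw [← ha, hb]; ring
      · exact pow_eq_zero_of_le hk h0
    rw [hx, Ideal.mem_span_singleton'] at hb'
    obtain ⟨c, rfl⟩ := hb'
    exact ⟨c, by rw [hb]; ring⟩

/-- Each layer `(x^k) / (x^(k+1))` is a copy of the residue field: since `x^k ≠ 0`, the preimage of
`(x^(k+1))` under multiplication by `x^k` is the maximal ideal. -/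
lemma index_span_singleton_pow [IsLocalRing A] {x : A} {e : ℕ}
    (hx : IsLocalRing.maximalIdeal A = Ideal.span {x}) (hne : x ^ (e - 1) ≠ 0) (k : ℕ)
    (hk : k ≤ e) :
    (Ideal.span {x ^ k}).toAddSubgroup.index =
      Nat.card (A ⧸ IsLocalRing.maximalIdeal A) ^ k := by
  induction k with
  | zero =>
    have : (Ideal.span {x ^ 0} : Ideal A).toAddSubgroup = ⊤ := by
      ext; simp [Ideal.span_singleton_one]
    rw [this]; simp
  | succ k ih =>
    have hle : (Ideal.span {x ^ (k + 1)}).toAddSubgroup ≤ (Ideal.span {x ^ k}).toAddSubgroup := by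
      have : Ideal.span {x ^ (k + 1)} ≤ Ideal.span {x ^ k} :=
        Ideal.span_singleton_le_span_singleton.2 (pow_dvd_pow x k.le_succ)
      exact this
    let f : A →+ A := AddMonoidHom.mulRight (x ^ k)
    have hrange : f.range = (Ideal.span {x ^ k}).toAddSubgroup := by
      ext a
      simp [f, Ideal.mem_span_singleton']
    have hcomap : (Ideal.span {x ^ (k + 1)}).toAddSubgroup.comap f =
        (IsLocalRing.maximalIdeal A).toAddSubgroup := by
      ext a
      simp only [AddSubgroup.mem_comap, Submodule.mem_toAddSubgroup, f,
        AddMonoidHom.mulRight_apply]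
      constructor
      · intro ha
        obtain ⟨b, hb⟩ := Ideal.mem_span_singleton'.1 ha
        have h1 : a - b * x ∈ IsLocalRing.maximalIdeal A := by
          refine mem_maximalIdeal_of_mul_eq_zero (b := x ^ k) ?_ fun h0 => hne ?_
          · linear_combination -hb
          · exact pow_eq_zero_of_le (by omega) h0
        have h2 : b * x ∈ IsLocalRing.maximalIdeal A := by
          rw [hx]; exact Ideal.mem_span_singleton'.2 ⟨b, rfl⟩
        simpa using add_mem h1 h2
      · intro ha
        rw [hx] at ha
        obtain ⟨b, rfl⟩ := Ideal.mem_span_singleton'.1 ha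
        exact Ideal.mem_span_singleton'.2 ⟨b, by ring⟩
    have hrel := (Ideal.span {x ^ (k + 1)}).toAddSubgroup.index_comap f
    rw [hrange, hcomap] at hrel
    rw [← AddSubgroup.relIndex_mul_index hle, ih (by omega), ← hrel, pow_succ, mul_comm]
    rfl

lemma card_eq_card_residue_pow [IsLocalRing A] {x : A} {e : ℕ}
    (hx : IsLocalRing.maximalIdeal A = Ideal.span {x}) (hxe : x ^ e = 0)
    (hne : x ^ (e - 1) ≠ 0) : Nat.card A = Nat.card (A ⧸ IsLocalRing.maximalIdeal A) ^ e := by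
  rw [← index_span_singleton_pow hx hne e le_rfl, hxe]
  have : (Ideal.span {0} : Ideal A).toAddSubgroup = ⊥ := by
    ext; simp
  rw [this, AddSubgroup.index_bot]

lemma card_maximalIdeal_mul_card_residue [IsLocalRing A] :
    Nat.card (IsLocalRing.maximalIdeal A) * Nat.card (A ⧸ IsLocalRing.maximalIdeal A) =
      Nat.card A :=
  (IsLocalRing.maximalIdeal A).toAddSubgroup.card_mul_index

lemma AddMonoidHom.card_ker_mul_card_range {G H : Type*} [AddGroup G] [AddGroup H] (f : G →+ H) :
    Nat.card f.ker * Nat.card f.range = Nat.card G := by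
  rw [← AddSubgroup.index_ker, AddSubgroup.card_mul_index]

lemma card_annihilator_generator [Finite A] [IsLocalRing A] {x : A}
    (hx : IsLocalRing.maximalIdeal A = Ideal.span {x}) :
    Nat.card (AddMonoidHom.mulRight x).ker = Nat.card (A ⧸ IsLocalRing.maximalIdeal A) := by
  have hrange : (AddMonoidHom.mulRight x).range = (IsLocalRing.maximalIdeal A).toAddSubgroup := by
    ext a
    simp [hx, Ideal.mem_span_singleton']
  have h1 := AddMonoidHom.card_ker_mul_card_range (AddMonoidHom.mulRight x)
  rw [hrange, ← card_maximalIdeal_mul_card_residue (A := A), mul_comm] at h1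
  exact Nat.eq_of_mul_eq_mul_left (Nat.card_pos (α := IsLocalRing.maximalIdeal A)) h1

end PrincipalLocalRing

/-! ### Symmetric and skew elements -/

section Involution

variable {A : Type*} [CommRing A] [StarRing A]

lemma exists_half (h2 : IsUnit (2 : A)) : ∃ c : A, 2 * c = 1 ∧ star c = c := by
  obtain ⟨c, hc⟩ := h2.exists_right_inv
  refine ⟨c, hc, h2.mul_left_cancel ?_⟩
  have := congrArg star hc
  rwa [star_mul', star_one, star_ofNat, ← hc] at this

lemma card_selfAdjoint_mul_card_skewAdjoint (h2 : IsUnit (2 : A)) :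
    Nat.card (selfAdjoint A) * Nat.card (skewAdjoint A) = Nat.card A := by
  obtain ⟨c, hc, hcs⟩ := exists_half h2
  rw [← Nat.card_prod]
  refine Nat.card_eq_of_bijective (fun p : selfAdjoint A × skewAdjoint A => p.1.1 + p.2.1) ⟨?_, ?_⟩
  · rintro ⟨⟨r, hr⟩, ⟨s, hs⟩⟩ ⟨⟨r', hr'⟩, ⟨s', hs'⟩⟩ heq
    dsimp only at heq
    rw [selfAdjoint.mem_iff] at hr hr'
    rw [skewAdjoint.mem_iff] at hs hs'
    have heq' := congrArg star heq
    rw [star_add, star_add, hr, hr', hs, hs'] at heq'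
    have e1 : r = r' := h2.mul_left_cancel (by linear_combination heq + heq')
    have e2 : s = s' := h2.mul_left_cancel (by linear_combination heq - heq')
    simp [e1, e2]
  · intro a
    refine ⟨(⟨c * (a + star a), ?_⟩, ⟨c * (a - star a), ?_⟩), ?_⟩
    · rw [selfAdjoint.mem_iff, star_mul', hcs, star_add, star_star, add_comm]
    · rw [skewAdjoint.mem_iff, star_mul', hcs, star_sub, star_star]; ring
    · dsimp only
      linear_combination a * hc

lemma card_skewAdjoint_of_forall_star_eq (h2 : IsUnit (2 : A)) (h1 : ∀ a : A, star a = a) :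
    Nat.card (skewAdjoint A) = 1 := by
  have : skewAdjoint A = ⊥ := by
    refine (AddSubgroup.eq_bot_iff_forall _).2 fun s hs => ?_
    rw [skewAdjoint.mem_iff, h1] at hs
    exact h2.mul_right_eq_zero.1 (by linear_combination hs)
  rw [this, AddSubgroup.card_bot]

/-- If no skew element generates, all skew elements lie in `(x²)`, so `y = (x + x^*)/2` differs from
`x` by an element of `(x²)` and is a symmetric generator. A skew `s = d y^k` then equals `((d -
d^*)/2) y^k`, which lies in `(y^(k+1))`. Hence skew elements lie in every power of `(y)` and vanish,
forcing `*` to be trivial. -/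
lemma exists_skew_generator_maximalIdeal [IsLocalRing A] (h2 : IsUnit (2 : A))
    (hstar : ∀ a : A, a - star a ∈ IsLocalRing.maximalIdeal A) {x : A} {e : ℕ}
    (hx : IsLocalRing.maximalIdeal A = Ideal.span {x}) (hxe : x ^ e = 0)
    (h1 : ¬ ∀ a : A, star a = a) :
    ∃ y : A, star y = -y ∧ IsLocalRing.maximalIdeal A = Ideal.span {y} := by
  by_contra hcon
  push Not at hcon
  obtain ⟨c, hc, hcs⟩ := exists_half h2
  have hxm : x ∈ IsLocalRing.maximalIdeal A := by rw [hx]; exact Ideal.mem_span_singleton_self x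
  have hsq : ∀ s : A, star s = -s → ∃ b, s = b * x * x := by
    intro s hs
    have hsm := mem_maximalIdeal_of_star_eq_neg h2 hstar hs
    rw [hx] at hsm
    obtain ⟨b, rfl⟩ := Ideal.mem_span_singleton'.1 hsm
    have hb : b ∈ IsLocalRing.maximalIdeal A := fun hb =>
      hcon _ hs (by rw [hx, Ideal.span_singleton_mul_left_unit hb])
    rw [hx] at hb
    obtain ⟨d, rfl⟩ := Ideal.mem_span_singleton'.1 hb
    exact ⟨d, rfl⟩
  obtain ⟨b, hb⟩ := hsq (c * (x - star x)) (by rw [star_mul', hcs, star_sub, star_star]; ring)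
  obtain ⟨y, hy⟩ : ∃ y, y = c * (x + star x) := ⟨_, rfl⟩
  have hys : star y = y := by rw [hy, star_mul', hcs, star_add, star_star, add_comm]
  have hyx : y = (1 + -(b * x)) * x := by
    linear_combination hy + x * hc - hb
  have hu : IsUnit (1 + -(b * x)) :=
    isUnit_add_mem_maximalIdeal isUnit_one (neg_mem (Ideal.mul_mem_left _ _ hxm))
  have hspan : IsLocalRing.maximalIdeal A = Ideal.span {y} := by
    rw [hx, hyx, Ideal.span_singleton_mul_left_unit hu]
  have hpow : ∀ k : ℕ, ∀ s : A, star s = -s → ∃ d, s = d * y ^ k := by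
    intro k
    induction k with
    | zero => exact fun s _ => ⟨s, by simp⟩
    | succ k ih =>
      intro s hs
      obtain ⟨d, hd⟩ := ih s hs
      have hm := hstar d
      rw [hspan] at hm
      obtain ⟨f, hf⟩ := Ideal.mem_span_singleton'.1 hm
      have hd' : -s = star d * y ^ k := by rw [← hs, hd, star_mul', star_pow, hys]
      refine ⟨c * f, ?_⟩
      linear_combination c * hd - c * hd' - s * hc - c * y ^ k * hf
  refine h1 fun a => ?_
  obtain ⟨d, hd⟩ := hpow e (a - star a) (by rw [star_sub, star_star]; ring)
  rw [hyx, mul_pow, hxe, mul_zero, mul_zero] at hd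
  exact (sub_eq_zero.1 hd).symm

/-- Multiplication by a skew generator maps the symmetric elements onto the skew ones. -/
lemma card_selfAdjoint_eq_card_annihilator_mul [Finite A] [IsLocalRing A] (h2 : IsUnit (2 : A))
    (hstar : ∀ a : A, a - star a ∈ IsLocalRing.maximalIdeal A) {y : A} (hys : star y = -y)
    (hy : IsLocalRing.maximalIdeal A = Ideal.span {y}) :
    Nat.card (selfAdjoint A) =
      Nat.card {a : A // star a = a ∧ a * y = 0} * Nat.card (skewAdjoint A) := by
  obtain ⟨c, hc, hcs⟩ := exists_half h2
  let f : selfAdjoint A →+ skewAdjoint A := AddMonoidHom.mk' (fun r => ⟨r.1 * y, by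
      rw [skewAdjoint.mem_iff, star_mul', hys, selfAdjoint.mem_iff.1 r.2]; ring⟩)
    fun r s => Subtype.ext (by simp [add_mul])
  have hf : Function.Surjective f := by
    rintro ⟨s, hs⟩
    have hs' := skewAdjoint.mem_iff.1 hs
    have hsm := mem_maximalIdeal_of_star_eq_neg h2 hstar hs'
    rw [hy] at hsm
    obtain ⟨b, hb⟩ := Ideal.mem_span_singleton'.1 hsm
    have hb' := congrArg star hb
    rw [star_mul', hys, hs'] at hb'
    -- Applying `*` to `b y = s` gives `b^* y = s`, so `b` may be replaced by its symmetric part.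
    refine ⟨⟨c * (b + star b), ?_⟩, Subtype.ext ?_⟩
    · rw [selfAdjoint.mem_iff, star_mul', hcs, star_add, star_star, add_comm]
    · change c * (b + star b) * y = s
      linear_combination c * hb - c * hb' + s * hc
  rw [← AddMonoidHom.card_ker_mul_card_range f, AddMonoidHom.range_eq_top.2 hf,
    AddSubgroup.card_top]
  congr 1
  refine Nat.card_congr
    { toFun := fun r => ⟨r.1.1, selfAdjoint.mem_iff.1 r.1.2, congrArg Subtype.val r.2⟩
      invFun := fun a => ⟨⟨a.1, selfAdjoint.mem_iff.2 a.2.1⟩, Subtype.ext a.2.2⟩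
      left_inv := fun _ => rfl
      right_inv := fun _ => rfl }

/-- Since `b ≡ b^*` modulo `y` and `y^(e-1)` is skew, every element `b y^(e-1)` of `Ann(y)` is skew;
a symmetric one is therefore zero. -/
lemma card_selfAdjoint_of_even [Finite A] [IsLocalRing A] (h2 : IsUnit (2 : A))
    (hstar : ∀ a : A, a - star a ∈ IsLocalRing.maximalIdeal A) {y : A} (hys : star y = -y)
    (hy : IsLocalRing.maximalIdeal A = Ideal.span {y}) {e : ℕ} (he : Odd (e - 1))
    (hye : y ^ e = 0) (hne : y ^ (e - 1) ≠ 0) :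
    Nat.card (selfAdjoint A) = Nat.card (skewAdjoint A) := by
  rw [card_selfAdjoint_eq_card_annihilator_mul h2 hstar hys hy]
  have hsub : ∀ a : {a : A // star a = a ∧ a * y = 0}, a = ⟨0, by simp⟩ := by
    rintro ⟨a, ha, hay⟩
    obtain ⟨b, hb⟩ := exists_eq_mul_pow_of_mul_eq_zero hy hne hay
    have hb' := congrArg star hb
    rw [star_mul', star_pow, hys, he.neg_pow, ha] at hb'
    have hm := hstar b
    rw [hy] at hm
    obtain ⟨d, hd⟩ := Ideal.mem_span_singleton'.1 hm
    have hye' : y ^ (e - 1) * y = 0 := by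
      rw [← pow_succ]; exact pow_eq_zero_of_le (by omega) hye
    refine Subtype.ext (h2.mul_right_eq_zero.1 ?_)
    linear_combination hb + hb' - y ^ (e - 1) * hd + d * hye'
  have : Nat.card {a : A // star a = a ∧ a * y = 0} = 1 :=
    Nat.card_eq_one_iff_exists.2 ⟨_, hsub⟩
  rw [this, one_mul]

/-- Here `y^(e-1)` is symmetric, so by the same congruence all of `Ann(y)` is symmetric and the
kernel has order `q`. -/
lemma card_selfAdjoint_of_odd [Finite A] [IsLocalRing A] (h2 : IsUnit (2 : A))
    (hstar : ∀ a : A, a - star a ∈ IsLocalRing.maximalIdeal A) {y : A} (hys : star y = -y)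
    (hy : IsLocalRing.maximalIdeal A = Ideal.span {y}) {e : ℕ} (he : Even (e - 1))
    (hye : y ^ e = 0) (hne : y ^ (e - 1) ≠ 0) :
    Nat.card (selfAdjoint A) =
      Nat.card (A ⧸ IsLocalRing.maximalIdeal A) * Nat.card (skewAdjoint A) := by
  rw [card_selfAdjoint_eq_card_annihilator_mul h2 hstar hys hy, ← card_annihilator_generator hy]
  congr 1
  refine Nat.card_congr (Equiv.subtypeEquivRight fun a => ⟨fun ha => ha.2, fun hay => ⟨?_, hay⟩⟩)
  have hay' : a * y = 0 := hay
  obtain ⟨b, hb⟩ := exists_eq_mul_pow_of_mul_eq_zero hy hne hay'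
  have hm := hstar b
  rw [hy] at hm
  obtain ⟨d, hd⟩ := Ideal.mem_span_singleton'.1 hm
  have hye' : y ^ (e - 1) * y = 0 := by
    rw [← pow_succ]; exact pow_eq_zero_of_le (by omega) hye
  rw [hb, star_mul', star_pow, hys, he.neg_pow]
  linear_combination y ^ (e - 1) * hd - d * hye'

end Involution

/-! ### The standard form and the order of its unitary group -/

section StandardForm

variable (m : ℕ) (A : Type*) [CommRing A] [StarRing A]

/-- The skew-hermitian form `(u, v) ↦ u^* J v` on column vectors. -/
def stdSkewHermitianForm :
    (Fin m ⊕ Fin m → A) →ₗ⋆[A] (Fin m ⊕ Fin m → A) →ₗ[A] A :=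
  LinearMap.mk₂'ₛₗ (starRingEnd A) (RingHom.id A)
    (fun u v => star u ⬝ᵥ (stdSkewForm m A *ᵥ v))
    (fun u u' v => by rw [star_add, add_dotProduct])
    (fun c u v => by
      rw [star_smul, smul_dotProduct]; rfl)
    (fun u v v' => by rw [mulVec_add, dotProduct_add])
    (fun c u v => by rw [mulVec_smul, dotProduct_smul]; rfl)

variable {m A}

lemma stdSkewHermitianForm_apply (u v : Fin m ⊕ Fin m → A) :
    stdSkewHermitianForm m A u v = star u ⬝ᵥ (stdSkewForm m A *ᵥ v) := rfl

lemma stdSkewHermitianForm_eq_sum (u v : Fin m ⊕ Fin m → A) :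
    stdSkewHermitianForm m A u v =
      ∑ i, star (u (Sum.inl i)) * v (Sum.inr i) - ∑ i, star (u (Sum.inr i)) * v (Sum.inl i) := by
  rw [stdSkewHermitianForm_apply, stdSkewForm, fromBlocks_mulVec]
  simp [dotProduct, sub_eq_add_neg, neg_mulVec]

lemma star_stdSkewHermitianForm (u v : Fin m ⊕ Fin m → A) :
    star (stdSkewHermitianForm m A u v) = -stdSkewHermitianForm m A v u := by
  simp [stdSkewHermitianForm_eq_sum, star_sum, mul_comm]

omit [StarRing A] in
lemma stdSkewForm_mul_self : stdSkewForm m A * stdSkewForm m A = -1 := by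
  rw [stdSkewForm, fromBlocks_multiply]
  ext i j
  rcases i with i | i <;> rcases j with j | j <;> simp [Matrix.one_apply]

/-- Pairing `u` with the standard basis reads off its coordinates up to sign and `*`, so the radical
consists of the vectors with all coordinates in the maximal ideal. -/
lemma card_residualRadical_stdSkewHermitianForm [IsLocalRing A] :
    Nat.card (residualRadical (stdSkewHermitianForm m A) ⊤) =
      Nat.card (IsLocalRing.maximalIdeal A) ^ (2 * m) := by
  have hmem : ∀ u, u ∈ residualRadical (stdSkewHermitianForm m A) ⊤ ↔
      ∀ i, u i ∈ IsLocalRing.maximalIdeal A := by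
    intro u
    have hs : ∀ a : A, star a ∈ IsLocalRing.maximalIdeal A ↔ a ∈ IsLocalRing.maximalIdeal A :=
      fun a => by simp
    constructor
    · rintro ⟨-, hu⟩ (i | i)
      · simpa [stdSkewHermitianForm_eq_sum, Pi.single_apply] using
          hu (Pi.single (Sum.inr i) 1) trivial
      · simpa [stdSkewHermitianForm_eq_sum, Pi.single_apply] using
          hu (Pi.single (Sum.inl i) 1) trivial
    · intro hu
      refine ⟨trivial, fun v _ => ?_⟩
      rw [stdSkewHermitianForm_eq_sum]
      exact sub_mem (sum_mem fun i _ => Ideal.mul_mem_right _ _ ((hs _).2 (hu _)))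
        (sum_mem fun i _ => Ideal.mul_mem_right _ _ ((hs _).2 (hu _)))
  have e : residualRadical (stdSkewHermitianForm m A) ⊤ ≃
      (Fin m ⊕ Fin m → IsLocalRing.maximalIdeal A) :=
    { toFun := fun u i => ⟨u.1 i, (hmem _).1 u.2 i⟩
      invFun := fun u => ⟨fun i => (u i).1, (hmem _).2 fun i => (u i).2⟩
      left_inv := fun _ => rfl
      right_inv := fun _ => rfl }
  rw [Nat.card_congr e, Nat.card_fun]
  simp [two_mul]

/-- The condition `X^* J X = J` says that the columns of `X` form a hyperbolic family. -/
lemma conjTranspose_mul_stdSkewForm_mul_apply (X : Matrix (Fin m ⊕ Fin m) (Fin m ⊕ Fin m) A)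
    (i j : Fin m ⊕ Fin m) :
    (Xᴴ * stdSkewForm m A * X) i j = stdSkewHermitianForm m A (X.col i) (X.col j) := by
  rw [Matrix.mul_assoc, stdSkewHermitianForm_apply, mul_apply']
  rfl

lemma conjTranspose_mul_stdSkewForm_mul_eq_iff
    (X : Matrix (Fin m ⊕ Fin m) (Fin m ⊕ Fin m) A) :
    Xᴴ * stdSkewForm m A * X = stdSkewForm m A ↔
      (fun i => X.col (Sum.inl i), fun i => X.col (Sum.inr i)) ∈
        hyperbolicFamilies (stdSkewHermitianForm m A) m ⊤ := by
  rw [← Matrix.ext_iff]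
  simp only [conjTranspose_mul_stdSkewForm_mul_apply]
  constructor
  · intro hX
    refine ⟨fun i => ⟨trivial, trivial⟩, fun i j => ⟨?_, ?_, ?_⟩⟩ <;>
      simp [hX, stdSkewForm, Matrix.one_apply]
  · rintro ⟨-, hX⟩ (i | i) (j | j)
    · simpa [stdSkewForm] using (hX i j).1
    · simpa [stdSkewForm, Matrix.one_apply] using (hX i j).2.2
    · have h1 := star_stdSkewHermitianForm (X.col (Sum.inl j)) (X.col (Sum.inr i))
      rw [(hX j i).2.2] at h1
      rw [← neg_eq_iff_eq_neg] at h1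
      rw [← h1]
      by_cases hij : i = j
      · simp [stdSkewForm, hij]
      · simp [stdSkewForm, hij, Ne.symm hij]
    · simpa [stdSkewForm] using (hX i j).2.1

lemma isUnit_of_conjTranspose_mul_stdSkewForm_mul_eq
    {X : Matrix (Fin m ⊕ Fin m) (Fin m ⊕ Fin m) A}
    (hX : Xᴴ * stdSkewForm m A * X = stdSkewForm m A) : IsUnit X := by
  have hinv : -(stdSkewForm m A * Xᴴ * stdSkewForm m A) * X = 1 := by
    rw [Matrix.neg_mul, Matrix.mul_assoc, Matrix.mul_assoc, ← Matrix.mul_assoc Xᴴ, hX,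
      stdSkewForm_mul_self, neg_neg]
  exact ⟨⟨X, _, mul_eq_one_comm.1 hinv, hinv⟩, rfl⟩

lemma card_skewUnitaryGroup_eq_card_matrices :
    Nat.card (skewUnitaryGroup m A) =
      Nat.card {X : Matrix (Fin m ⊕ Fin m) (Fin m ⊕ Fin m) A //
        Xᴴ * stdSkewForm m A * X = stdSkewForm m A} :=
  Nat.card_congr
    { toFun := fun X => ⟨X.1.val, X.2⟩
      invFun := fun X => ⟨(isUnit_of_conjTranspose_mul_stdSkewForm_mul_eq X.2).unit, X.2⟩
      left_inv := fun _ => Subtype.ext (Units.ext rfl)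
      right_inv := fun _ => rfl }

lemma card_skewUnitaryGroup_eq_card_hyperbolicFamilies :
    Nat.card (skewUnitaryGroup m A) =
      Nat.card (hyperbolicFamilies (stdSkewHermitianForm m A) m ⊤) := by
  rw [card_skewUnitaryGroup_eq_card_matrices]
  refine Nat.card_congr
    { toFun := fun X => ⟨_, (conjTranspose_mul_stdSkewForm_mul_eq_iff X.1).1 X.2⟩
      invFun := fun f => ⟨Matrix.of fun i j => Sum.elim f.1.1 f.1.2 j i,
        (conjTranspose_mul_stdSkewForm_mul_eq_iff _).2 f.2⟩
      left_inv := fun X => ?_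
      right_inv := fun f => rfl }
  ext i (j | j) <;> rfl

lemma card_skewUnitaryGroup_eq_card_symplecticGroup (h1 : ∀ a : A, star a = a) :
    Nat.card (skewUnitaryGroup m A) = Nat.card (Matrix.symplecticGroup (Fin m) A) := by
  rw [card_skewUnitaryGroup_eq_card_matrices]
  refine Nat.card_congr (Equiv.subtypeEquivRight fun X => ?_)
  -- `Matrix.J` has the opposite sign, which does not affect the group.
  have hJ : stdSkewForm m A = -Matrix.J (Fin m) A := by
    rw [stdSkewForm, Matrix.J, fromBlocks_neg]; simp
  have hX : Xᴴ = Xᵀ := by ext i j; simp [h1]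
  rw [SymplecticGroup.mem_iff', hX, hJ, Matrix.mul_neg, Matrix.neg_mul, neg_inj]

/-- The order of the unitary group in terms of `q`, `e` and the number `q ^ s` of skew elements. -/
lemma card_skewUnitaryGroup_mul [Finite A] [IsLocalRing A]
    (h2 : IsUnit (2 : A)) (hstar : ∀ a : A, a - star a ∈ IsLocalRing.maximalIdeal A)
    {q e s : ℕ} (hA : Nat.card A = q ^ (e + 1))
    (hM : Nat.card (IsLocalRing.maximalIdeal A) = q ^ e)
    (hS : Nat.card (skewAdjoint A) = q ^ s) :
    Nat.card (skewUnitaryGroup m A) * q ^ ((2 * s + e + 1) * m) =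
      q ^ ((2 * e + 1) * (m ^ 2 + m)) * ∏ i ∈ Finset.Icc 1 m, (q ^ (2 * i) - 1) := by
  -- In this lemma `e` is one less than the nilpotency degree.
  have key := card_hyperbolicFamilies_mul (h := stdSkewHermitianForm m A)
    star_stdSkewHermitianForm h2 hstar m ⊤ (by
      rw [Nat.card_congr Submodule.topEquiv.toEquiv, Nat.card_fun]
      simp [two_mul]) card_residualRadical_stdSkewHermitianForm
  rw [← card_skewUnitaryGroup_eq_card_hyperbolicFamilies, hA, hM, hS] at key
  have hl : q ^ ((2 * s + e + 1) * m) = ((q ^ s) ^ 2 * q ^ (e + 1)) ^ m := by ring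
  rw [hl, key]
  clear key hl
  induction m with
  | zero => simp
  | succ m ih =>
    rw [Finset.prod_Icc_succ_top (by omega), Finset.prod_Icc_succ_top (by omega), ih]
    have : (q ^ (e + 1)) ^ (2 * (m + 1)) - (q ^ e) ^ (2 * (m + 1)) =
        q ^ (2 * e * (m + 1)) * (q ^ (2 * (m + 1)) - 1) := by
      rw [Nat.mul_sub]; ring_nf
    rw [this]
    ring

end StandardForm

/-! ### The three cases -/

theorem mainTheorem9 {A : Type*} [CommRing A] [Finite A] [IsLocalRing A] [IsPrincipalIdealRing A]
    [StarRing A]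
    (hodd : Odd (ringChar (A ⧸ Ring.jacobson A)))
    (hstar : ∀ a : A, a - star a ∈ Ring.jacobson A)
    (q e : ℕ)
    (hq : q = Nat.card (A ⧸ Ring.jacobson A))
    (he : e = nilpotencyClass (Ring.jacobson A))
    (m : ℕ) :
    ((∀ a : A, star a = a) →
      Nat.card (skewUnitaryGroup m A) = Nat.card (Matrix.symplecticGroup (Fin m) A) ∧
      Nat.card (skewUnitaryGroup m A) =
        q ^ ((e - 1) * (2 * m ^ 2 + m) + m ^ 2) * ∏ i ∈ Finset.Icc 1 m, (q ^ (2 * i) - 1)) ∧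
    ((¬ ∀ a : A, star a = a) → ∀ l : ℕ, e = 2 * l →
      Nat.card (skewUnitaryGroup m A) =
        q ^ ((2 * l - 1) * (2 * m ^ 2 - m)) * q ^ (2 * (l - 1) * m) * q ^ (m ^ 2) *
          ∏ i ∈ Finset.Icc 1 m, (q ^ (2 * i) - 1)) ∧
    ((¬ ∀ a : A, star a = a) → ∀ l : ℕ, e + 1 = 2 * l →
      Nat.card (skewUnitaryGroup m A) =
        q ^ ((2 * l - 2) * (2 * m ^ 2 - m)) * q ^ (2 * (l - 1) * m) * q ^ (m ^ 2) *
          ∏ i ∈ Finset.Icc 1 m, (q ^ (2 * i) - 1)) := by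
  have hJ : Ring.jacobson A = IsLocalRing.maximalIdeal A :=
    IsLocalRing.ringJacobson_eq_maximalIdeal A
  have hnil : IsNilpotent (Ring.jacobson A) := IsSemiprimaryRing.isNilpotent
  rw [hJ] at hodd hq he hnil
  simp only [hJ] at hstar
  have h2 : IsUnit (2 : A) := by
    by_contra hc
    have hmem : (2 : A) ∈ IsLocalRing.maximalIdeal A := hc
    rw [← Ideal.Quotient.eq_zero_iff_mem, map_ofNat] at hmem
    have hdvd : ringChar (A ⧸ IsLocalRing.maximalIdeal A) ∣ 2 :=
      ringChar.dvd (by exact_mod_cast hmem)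
    rcases (Nat.dvd_prime Nat.prime_two).1 hdvd with h | h
    · exact CharP.ringChar_ne_one h
    · rw [h] at hodd
      exact absurd hodd (by decide)
  obtain ⟨x, hx⟩ := (IsPrincipalIdealRing.principal (IsLocalRing.maximalIdeal A)).principal
  rw [← Ideal.span] at hx
  have hgen : ∀ y : A, IsLocalRing.maximalIdeal A = Ideal.span {y} →
      y ^ e = 0 ∧ y ^ (e - 1) ≠ 0 := by
    intro y hy
    have hp := pow_nilpotencyClass hnil
    have hp' := pow_pred_nilpotencyClass hnil
    rw [← he, hy, Ideal.span_singleton_pow] at hp hp'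
    exact ⟨by simpa using hp, by simpa using hp'⟩
  obtain ⟨hxe, hxne⟩ := hgen x hx
  have hepos : 0 < e := by
    rw [he]; exact pos_nilpotencyClass_iff.2 hnil
  have hA := card_eq_card_residue_pow hx hxe hxne
  rw [← hq] at hA
  have hqpos : 0 < q := by
    have : Finite (A ⧸ IsLocalRing.maximalIdeal A) :=
      Finite.of_surjective _ Ideal.Quotient.mk_surjective
    rw [hq]; exact Nat.card_pos
  have hM : Nat.card (IsLocalRing.maximalIdeal A) = q ^ (e - 1) := by
    apply Nat.eq_of_mul_eq_mul_right hqpos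
    rw [← pow_succ, Nat.sub_add_cancel hepos, ← hA, hq]
    exact card_maximalIdeal_mul_card_residue
  have hmsq : m ≤ 2 * m ^ 2 := by nlinarith [Nat.le_self_pow two_ne_zero m]
  -- Only `|S| = q^s` still depends on the case: `s` is `0`, `l`, `l - 1` in (a), (b), (c).
  have finish : ∀ {s E : ℕ}, Nat.card (skewAdjoint A) = q ^ s →
      E + (2 * s + e) * m = (2 * e - 1) * (m ^ 2 + m) →
      Nat.card (skewUnitaryGroup m A) = q ^ E * ∏ i ∈ Finset.Icc 1 m, (q ^ (2 * i) - 1) := by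
    intro s E hS hE
    obtain ⟨k, rfl⟩ : ∃ k, e = k + 1 := ⟨e - 1, by omega⟩
    have key := card_skewUnitaryGroup_mul (m := m) h2 hstar hA hM hS
    apply Nat.eq_of_mul_eq_mul_right (pow_pos hqpos ((2 * s + k + 1) * m))
    have : (2 * (k + 1) - 1) = 2 * k + 1 := by omega
    rw [key, ← this, ← hE, pow_add]
    ring
  have hRS := card_selfAdjoint_mul_card_skewAdjoint h2
  refine ⟨fun h1 => ⟨card_skewUnitaryGroup_eq_card_symplecticGroup h1, ?_⟩,
    fun h1 l hl => ?_, fun h1 l hl => ?_⟩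
  · refine finish (s := 0) (by simpa using card_skewAdjoint_of_forall_star_eq h2 h1) ?_
    obtain ⟨k, rfl⟩ : ∃ k, e = k + 1 := ⟨e - 1, by omega⟩
    have : (2 * (k + 1) - 1) = 2 * k + 1 := by omega
    rw [this, Nat.add_sub_cancel]
    ring
  · obtain ⟨y, hys, hy⟩ := exists_skew_generator_maximalIdeal h2 hstar hx hxe h1
    obtain ⟨hye, hyne⟩ := hgen y hy
    have hR := card_selfAdjoint_of_even h2 hstar hys hy (by subst hl; exact ⟨l - 1, by omega⟩)
      hye hyne
    have hS : Nat.card (skewAdjoint A) = q ^ l := by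
      rw [hR, hA, hl, ← sq, mul_comm 2 l, pow_mul] at hRS
      exact Nat.pow_left_injective two_ne_zero hRS
    rw [← pow_add, ← pow_add]
    refine finish hS ?_
    obtain ⟨k, rfl⟩ : ∃ k, l = k + 1 := ⟨l - 1, by omega⟩
    -- `d` stands for `2m² - m`, which removes the truncated subtraction.
    obtain ⟨d, hd⟩ := Nat.exists_eq_add_of_le hmsq
    have e1 : 2 * (k + 1) - 1 = 2 * k + 1 := by omega
    have e2 : 2 * (2 * (k + 1)) - 1 = 4 * k + 3 := by omega
    rw [hl, e1, e2, Nat.add_sub_cancel, hd, Nat.add_sub_cancel_left]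
    nlinarith [congrArg (fun z => (2 * k + 1) * z) hd]
  · obtain ⟨y, hys, hy⟩ := exists_skew_generator_maximalIdeal h2 hstar hx hxe h1
    obtain ⟨hye, hyne⟩ := hgen y hy
    have hR := card_selfAdjoint_of_odd h2 hstar hys hy
      (by exact ⟨l - 1, by omega⟩) hye hyne
    obtain ⟨k, rfl⟩ : ∃ k, l = k + 1 := ⟨l - 1, by omega⟩
    obtain rfl : e = 2 * k + 1 := by omega
    have hS : Nat.card (skewAdjoint A) = q ^ k := by
      -- The relation becomes `q |S|² = q^(2k+1)`.
      rw [hR, hA, ← hq, mul_assoc, ← sq, pow_succ' q, mul_comm 2 k, pow_mul] at hRS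
      exact Nat.pow_left_injective two_ne_zero (Nat.eq_of_mul_eq_mul_left hqpos hRS)
    rw [← pow_add, ← pow_add]
    refine finish hS ?_
    obtain ⟨d, hd⟩ := Nat.exists_eq_add_of_le hmsq
    have e1 : 2 * (k + 1) - 2 = 2 * k := by omega
    have e2 : 2 * (2 * k + 1) - 1 = 4 * k + 1 := by omega
    rw [e1, e2, Nat.add_sub_cancel, hd, Nat.add_sub_cancel_left]
    nlinarith [congrArg (fun z => 2 * k * z) hd]
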